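/- **Theorem 3.1.** Let $k$ be a field, let $A$ and $B$ be finite-dimensional $k$-algebras with $\mathrm{gl.dim}\, B<\infty$, and put $\Lambda=A\otimes_k B$. All modules are finitely generated, and modules are left modules unless stated otherwise. For a module $M$ over a finite-dimensional algebra $R$, let ${}^\perp M$ be the full subcategory of the $R$-modules $X$ with $\mathrm{Ext}_R^i(X,M)=0$ for all $i\ge 1$, and let $\mathrm{add}(M)$ be the full subcategory of direct summands of finite direct sums of copies of $M$. Let $\mathrm{mon}(B,A)$ be the full subcategory of the $\Lambda$-modules $X$ such that $\mathrm{Tor}_i^{\Lambda}(A\otimes_k V,X)=0$ for all $i\ge 1$ and all right $B$-modules $V$. For a full subcategory $\mathscr C$ of the category of $A$-modules, let $\mathrm{mon}(B,\mathscr C)$ be the full subcategory of those $X\in\mathrm{mon}(B,A)$ such that the $A$-module $(A\otimes_k V)\otimes_\Lambda X$ is in $\mathscr C$ for all right $B$-modules $V$. Let $\mathrm D=\mathrm{Hom}_k(-,k)$. Let $T$ be an $A$-module. Then $$\mathrm{mon}(B,{}^\perp T)=\mathrm{mon}(B,A)\cap{}^\perp(T\otimes_k B).$$ Moreover, if there is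 an exact sequence of $A$-modules $0\to T_m\to\cdots\to T_0\to \mathrm D(A_A)\to 0$ with each $T_j\in\mathrm{add}(T)$, then $$\mathrm{mon}(B,{}^\perp T)={}^\perp(T\otimes_k B).$$ In particular, $\mathrm{mon}(B,{}^\perp A)=\mathrm{mon}(B,A)\cap{}^\perp\Lambda$; and if $\mathrm{inj.dim}\,A_A<\infty$, then ${}^\perp\Lambda=\mathrm{mon}(B,{}^\perp A)$. -/

import Mathlib

open CategoryTheory MulOpposite
open scoped TensorProduct

universe u

/- Conventions. Modules are left modules; a right `R`-module is a module over `Rᵐᵒᵖ`, with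
`x r = op r • x`. A full subcategory of `R`-mod, the category of finitely generated left
`R`-modules, is given by an `ObjectProperty` of `ModuleCat R`. -/

namespace MonicModules

noncomputable section

section BalancedTensor

/- Mathlib has tensor products over commutative rings only. Here is the tensor product `M ⊗_R X` over
an arbitrary ring `R`, where `M` is an `S`-`R`-bimodule and `X` is a left `R`-module. -/

variable (S R M X : Type u) [Ring S] [Ring R] [AddCommGroup M] [Module S M] [Module Rᵐᵒᵖ M]
  [AddCommGroup X] [Module R X]

/-- The `S`-submodule of `M ⊗_ℤ X` generated by the elements `m r ⊗ x - m ⊗ r x`. -/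
def balancedRel : Submodule S (M ⊗[ℤ] X) :=
  Submodule.span S {z | ∃ (m : M) (r : R) (x : X), z = (op r • m) ⊗ₜ[ℤ] x - m ⊗ₜ[ℤ] (r • x)}

/-- The tensor product `M ⊗_R X` of an `S`-`R`-bimodule `M` with a left `R`-module `X`, as a left
`S`-module. When the two actions on `M` commute, the set of relations is stable under `S`, so the
underlying group is the usual one and does not depend on `S`. -/
abbrev BalancedTensor : Type u := (M ⊗[ℤ] X) ⧸ balancedRel S R M X

variable {X} {Y Z : Type u} [AddCommGroup Y] [Module R Y] [AddCommGroup Z] [Module R Z]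

/-- The map `M ⊗_R f : M ⊗_R X → M ⊗_R Y`, `m ⊗ x ↦ m ⊗ f x`. -/
def BalancedTensor.map (f : X →ₗ[R] Y) : BalancedTensor S R M X →ₗ[S] BalancedTensor S R M Y :=
  Submodule.mapQ _ _
    (TensorProduct.AlgebraTensorModule.lTensor S M f.toAddMonoidHom.toIntLinearMap) <| by
      rw [balancedRel, Submodule.span_le]
      rintro _ ⟨m, r, x, rfl⟩
      refine Submodule.subset_span ⟨m, r, f x, ?_⟩
      simp

variable {S R M} in
lemma BalancedTensor.hom_ext {N : Type u} [AddCommGroup N] [Module S N]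
    {f g : BalancedTensor S R M X →ₗ[S] N}
    (h : ∀ (m : M) (x : X), f (Submodule.Quotient.mk (m ⊗ₜ[ℤ] x)) =
      g (Submodule.Quotient.mk (m ⊗ₜ[ℤ] x))) : f = g := by
  refine LinearMap.ext fun z => ?_
  obtain ⟨z, rfl⟩ := Submodule.Quotient.mk_surjective _ z
  induction z using TensorProduct.induction_on with
  | zero => simp only [Submodule.Quotient.mk_zero, map_zero]
  | tmul m x => exact h m x
  | add a b ha hb => simp only [Submodule.Quotient.mk_add, map_add, ha, hb]

lemma BalancedTensor.map_id :
    BalancedTensor.map S R M (LinearMap.id : X →ₗ[R] X) = LinearMap.id :=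
  BalancedTensor.hom_ext fun _ _ => rfl

lemma BalancedTensor.map_comp (g : Y →ₗ[R] Z) (f : X →ₗ[R] Y) :
    BalancedTensor.map S R M (g.comp f) =
      (BalancedTensor.map S R M g).comp (BalancedTensor.map S R M f) :=
  BalancedTensor.hom_ext fun _ _ => rfl

lemma BalancedTensor.map_add (f g : X →ₗ[R] Y) :
    BalancedTensor.map S R M (f + g) = BalancedTensor.map S R M f + BalancedTensor.map S R M g :=
  BalancedTensor.hom_ext fun m x => by
    change Submodule.Quotient.mk (m ⊗ₜ[ℤ] (f x + g x)) = _
    rw [TensorProduct.tmul_add, Submodule.Quotient.mk_add]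
    rfl

/-- The functor `M ⊗_R - : R-Mod ⥤ S-Mod`, for an `S`-`R`-bimodule `M`. -/
def tensorFunctor [SMulCommClass S Rᵐᵒᵖ M] : ModuleCat.{u} R ⥤ ModuleCat.{u} S where
  obj X := ModuleCat.of S (BalancedTensor S R M X)
  map f := ModuleCat.ofHom (BalancedTensor.map S R M f.hom)
  map_id _ := ModuleCat.hom_ext (BalancedTensor.map_id S R M)
  map_comp f g := ModuleCat.hom_ext (BalancedTensor.map_comp S R M g.hom f.hom)

instance tensorFunctor_additive [SMulCommClass S Rᵐᵒᵖ M] : (tensorFunctor S R M).Additive where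
  map_add {_ _ f g} := ModuleCat.hom_ext (BalancedTensor.map_add S R M f.hom g.hom)

/-- `Tor_i^R(M, X)` for an `S`-`R`-bimodule `M` and a left `R`-module `X`, with its left `S`-module
structure: the `i`-th left derived functor of `M ⊗_R -`, evaluated at `X`. -/
def torModule [SMulCommClass S Rᵐᵒᵖ M] (i : ℕ) (X : ModuleCat.{u} R) : ModuleCat.{u} S :=
  ((tensorFunctor S R M).leftDerived i).obj X

end BalancedTensor

section OuterTensor

/- The left `A ⊗ B`-module `M ⊗ N`, for a left `A`-module `M` and a left `B`-module `N`. -/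

variable (k A B M N : Type u) [Field k] [Ring A] [Algebra k A] [Ring B] [Algebra k B]
  [AddCommGroup M] [Module k M] [Module A M] [IsScalarTower k A M]
  [AddCommGroup N] [Module k N] [Module B N] [IsScalarTower k B N]

/-- The tensor product `M ⊗_k N` of an `A`-module and a `B`-module, as a module over `A ⊗_k B`. -/
def OuterTensor (k M N : Type u) [Field k] [AddCommGroup M] [Module k M] [AddCommGroup N]
    [Module k N] : Type u := M ⊗[k] N

instance : AddCommGroup (OuterTensor k M N) := inferInstanceAs (AddCommGroup (M ⊗[k] N))

/-- The action `(a ⊗ b) (m ⊗ n) = a m ⊗ b n`. -/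
def outerAction : A ⊗[k] B →ₐ[k] Module.End k (M ⊗[k] N) :=
  (Module.endTensorEndAlgHom (R := k) (S := k) (A := k) (M := M) (N := N)).comp
    (Algebra.TensorProduct.map (Algebra.lsmul k k M) (Algebra.lsmul k k N))

instance : Module (A ⊗[k] B) (OuterTensor k M N) :=
  Module.compHom (M ⊗[k] N) (outerAction k A B M N).toRingHom

lemma OuterTensor.smul_tmul (a : A) (b : B) (m : M) (n : N) :
    (a ⊗ₜ[k] b) • (show OuterTensor k M N from m ⊗ₜ[k] n) = (a • m) ⊗ₜ[k] (b • n) := rfl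

end OuterTensor

section InducedBimodule

/- The `A`-`A ⊗ B`-bimodule `A ⊗ V`, for a right `B`-module `V`. -/

variable (k A B V : Type u) [Field k] [Ring A] [Algebra k A] [Ring B] [Algebra k B]
  [AddCommGroup V] [Module k V] [Module Bᵐᵒᵖ V] [IsScalarTower k Bᵐᵒᵖ V]

/-- The tensor product `A ⊗_k V` of the algebra `A` with a right `B`-module `V`, as a left module
over `A` and a right module over `A ⊗_k B`. -/
def InducedBimodule (k A V : Type u) [Field k] [Ring A] [Algebra k A] [AddCommGroup V]
    [Module k V] : Type u := A ⊗[k] V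

instance : AddCommGroup (InducedBimodule k A V) := inferInstanceAs (AddCommGroup (A ⊗[k] V))

instance : Module A (InducedBimodule k A V) := inferInstanceAs (Module A (A ⊗[k] V))

/-- The right action `(a' ⊗ v) (a ⊗ b) = a' a ⊗ v b`; it is by left `A`-linear maps. -/
def inducedAction : (A ⊗[k] B)ᵐᵒᵖ →ₐ[k] Module.End A (A ⊗[k] V) :=
  ((Module.endTensorEndAlgHom (R := k) (S := k) (A := A) (M := A) (N := V)).comp
    (Algebra.TensorProduct.map (Algebra.lsmul k A A : Aᵐᵒᵖ →ₐ[k] Module.End A A)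
      (Algebra.lsmul k k V : Bᵐᵒᵖ →ₐ[k] Module.End k V))).comp
    (Algebra.TensorProduct.opAlgEquiv k k A B).symm.toAlgHom

instance : Module (A ⊗[k] B)ᵐᵒᵖ (InducedBimodule k A V) :=
  Module.compHom (A ⊗[k] V) (inducedAction k A B V).toRingHom

lemma InducedBimodule.smul_tmul (a' a : A) (b : B) (v : V) :
    op (a ⊗ₜ[k] b) • (show InducedBimodule k A V from a' ⊗ₜ[k] v) =
      (a' * a) ⊗ₜ[k] (op b • v) := rfl

lemma InducedBimodule.left_smul_tmul (a' a : A) (v : V) :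
    a • (show InducedBimodule k A V from a' ⊗ₜ[k] v) = (a * a') ⊗ₜ[k] v := rfl

instance : SMulCommClass A (A ⊗[k] B)ᵐᵒᵖ (InducedBimodule k A V) where
  smul_comm a r z := ((inducedAction k A B V r).map_smul a z).symm

end InducedBimodule

section Dual

variable (k M : Type u) [Field k] [AddCommGroup M] [Module k M]

/-- The dual `D(M) = Hom_k(M, k)` of a right `A`-module `M`, to be regarded as a left `A`-module. -/
def DualModule : Type u := Module.Dual k M

instance : AddCommGroup (DualModule k M) := inferInstanceAs (AddCommGroup (Module.Dual k M))

variable (A : Type u) [Ring A] [Algebra k A] [Module Aᵐᵒᵖ M] [IsScalarTower k Aᵐᵒᵖ M]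

/-- The action `(a f) x = f (x a)`. -/
instance : Module A (DualModule k M) where
  smul a f := LinearMap.comp (show M →ₗ[k] k from f) (Algebra.lsmul k k M (op a))
  one_smul f := LinearMap.ext fun x => congrArg (show M →ₗ[k] k from f) (one_smul Aᵐᵒᵖ x)
  mul_smul a b f := LinearMap.ext fun x =>
    congrArg (show M →ₗ[k] k from f) (mul_smul (op b) (op a) x)
  smul_zero _ := rfl
  smul_add _ _ _ := rfl
  add_smul a b f := LinearMap.ext fun x =>
    (congrArg (show M →ₗ[k] k from f) (add_smul (op a) (op b) x)).trans
      (map_add (show M →ₗ[k] k from f) (op a • x) (op b • x))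
  zero_smul f := LinearMap.ext fun x =>
    (congrArg (show M →ₗ[k] k from f) (zero_smul Aᵐᵒᵖ x)).trans
      (map_zero (show M →ₗ[k] k from f))

lemma DualModule.smul_apply (a : A) (f : Module.Dual k M) (x : M) :
    (show Module.Dual k M from a • (show DualModule k M from f)) x = f (op a • x) := rfl

end Dual

section Homological

variable (R : Type u) [Ring R]

/-- The (left) global dimension of `R`: the supremum of the projective dimensions of the finitely
generated left `R`-modules. -/
def globalDimension : WithBot ℕ∞ :=
  ⨆ (M : ModuleCat.{u} R) (_ : Module.Finite R M), projectiveDimension M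

variable {R}

/-- The subcategory `⊥M` of `R`-mod: the finitely generated left `R`-modules `X` with
`Ext^i(X, M) = 0` for all `i ≥ 1`. -/
def leftPerp (M : ModuleCat.{u} R) : ObjectProperty (ModuleCat.{u} R) := fun X =>
  Module.Finite R X ∧ ∀ i : ℕ, 1 ≤ i → Subsingleton (Abelian.Ext X M i)

/-- The subcategory `add(T)` of `R`-mod: the direct summands of finite direct sums of copies
of `T`. -/
def addClosure (T : ModuleCat.{u} R) : ObjectProperty (ModuleCat.{u} R) := fun X =>
  ∃ (n : ℕ) (Y : ModuleCat.{u} R), Nonempty ((X × Y) ≃ₗ[R] (Fin n → T))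

/-- There is an exact sequence `0 → T_m → ⋯ → T_0 → M → 0` with all `T_j` in `add(T)`. The sequence is
continued by zero modules on the left. -/
def HasFiniteAddResolution (T M : ModuleCat.{u} R) : Prop :=
  ∃ (m : ℕ) (P : ℕ → ModuleCat.{u} R) (d : ∀ j, P (j + 1) →ₗ[R] P j) (ε : P 0 →ₗ[R] M),
    (∀ j ≤ m, addClosure T (P j)) ∧ (∀ j > m, Subsingleton (P j)) ∧
      Function.Surjective ε ∧ Function.Exact (d 0) ε ∧
        ∀ j, Function.Exact (d (j + 1)) (d j)

end Homological

section Monic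

variable (k A B : Type u) [Field k] [Ring A] [Algebra k A] [Ring B] [Algebra k B]

/-- The monomorphism category `mon(B, A)`: the finitely generated left `A ⊗ B`-modules `X` such that
`Tor_i(A ⊗ V, X) = 0` over `A ⊗ B`, for all `i ≥ 1` and all finitely generated right
`B`-modules `V`. -/
def mon : ObjectProperty (ModuleCat.{u} (A ⊗[k] B)) := fun X =>
  Module.Finite (A ⊗[k] B) X ∧
    ∀ (V : Type u) [AddCommGroup V] [Module k V] [Module Bᵐᵒᵖ V] [IsScalarTower k Bᵐᵒᵖ V]
      [Module.Finite Bᵐᵒᵖ V], ∀ i : ℕ, 1 ≤ i →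
        Limits.IsZero (torModule A (A ⊗[k] B) (InducedBimodule k A V) i X)

variable {A}

/-- The monomorphism category `mon(B, C)` over a full subcategory `C` of `A`-mod: the modules `X` in
`mon(B, A)` such that the left `A`-module `(A ⊗ V) ⊗_{A ⊗ B} X` lies in `C` for all finitely
generated right `B`-modules `V`. -/
def monOver (C : ObjectProperty (ModuleCat.{u} A)) : ObjectProperty (ModuleCat.{u} (A ⊗[k] B)) :=
  fun X => mon k A B X ∧
    ∀ (V : Type u) [AddCommGroup V] [Module k V] [Module Bᵐᵒᵖ V] [IsScalarTower k Bᵐᵒᵖ V]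
      [Module.Finite Bᵐᵒᵖ V],
        C ((tensorFunctor A (A ⊗[k] B) (InducedBimodule k A V)).obj X)

end Monic

end

end MonicModules

/-!
Let `Λ = A ⊗ B`. For a right `B`-module `V`, the functor `X ↦ (A ⊗ V) ⊗_Λ X` from `Λ`-modules to
`A`-modules has the exact right adjoint `H_V : T ↦ Hom_A(A ⊗ V, T)` (`tensorHomAdjunction`), and for
finite-dimensional `V` there is a natural isomorphism `H_V T ≅ T ⊗_k D(V)` (`outerDualEquiv`). Two
facts about such an adjunction `G ⊣ H` carry the proof; both come from comparing `Hom(P, H E)` with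
`Hom(G P, E)` for a projective resolution `P` of `X`.

* If the left derived functors of `G` vanish at `X`, then `G P` is a projective resolution of `G X`,
  and `Ext(X, H T)` vanishes if and only if `Ext(G X, T)` does (`rightPerp_map_iff`). Hence a module
  `X` in `mon(B, A)` lies in `mon(B, ⊥T)` if and only if `Ext^i(X, T ⊗ D(V)) = 0` for all `i ≥ 1`
  and all `V`.

* If `E` is an injective cogenerator, then the left derived functors of `G` vanish at `X` if and
  only if `Ext(X, H E)` does (`forall_isZero_leftDerived_iff`). With `E = D(A_A)`, this describes
  `mon(B, A)` by the conditions `Ext^i(X, D(A) ⊗ D(V)) = 0`.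

For fixed `X`, the modules `Y` with `Ext^i(X, Y) = 0` for all `i ≥ 1` form a class that is closed
under direct summands, extensions and cokernels of monomorphisms (`CokernelClosed`). Since `B` has
finite global dimension, each `D(V)` has a finite projective resolution, so that `T ⊗ D(V)` is in
the class for all `V` as soon as `T ⊗ B` is (`rightPerp_coinduced`); conversely `B ≅ D(D(B))` is
itself of the form `D(V)`. In the same way, a finite `add(T)`-resolution of `D(A)` puts `D(A) ⊗ B`
into the class when `T ⊗ B` is there, so that `⊥(T ⊗ B)` is contained in `mon(B, A)`
(`leftPerp_le_mon`). For `T = A` the resolution is replaced by the finiteness of the injective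
dimension of `A_A`, the dual of `D(A)`: the dual of a free presentation is an injective
copresentation, and a surjection splits when its dual does
(`CokernelClosed.of_hasInjectiveDimensionLT_rightDual`).
-/

namespace MonicModules

noncomputable section

section AbelianCategory

open Limits Abelian

universe w v v' u₁ u₂

variable {C : Type u₁} [Category.{v} C] [Abelian C]

/-! ### Vanishing of `Ext` and short exact sequences -/

/-- A class of objects which contains the zero objects and is closed under direct summands,
extensions and cokernels of monomorphisms. -/
structure CokernelClosed (Q : ObjectProperty C) : Prop where
  zero : ∀ {X : C}, IsZero X → Q X
  retract : ∀ {X Y : C}, Retract X Y → Q Y → Q X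
  extension : ∀ {S : ShortComplex C}, S.ShortExact → Q S.X₁ → Q S.X₃ → Q S.X₂
  cokernel : ∀ {S : ShortComplex C}, S.ShortExact → Q S.X₁ → Q S.X₂ → Q S.X₃

lemma CokernelClosed.iso {Q : ObjectProperty C} (hQ : CokernelClosed Q) {X Y : C} (e : X ≅ Y)
    (hX : Q X) : Q Y :=
  hQ.retract e.symm.retract hX

/-- The objects `Y` with `Ext^i(X, Y) = 0` for all `i ≥ 1`. -/
def rightPerp [HasExt.{w} C] (X : C) : ObjectProperty C :=
  fun Y => ∀ i : ℕ, 1 ≤ i → Subsingleton (Ext.{w} X Y i)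

lemma rightPerp_cokernelClosed [HasExt.{w} C] (X : C) :
    CokernelClosed (rightPerp.{w} X) where
  zero hY i _ := subsingleton_of_forall_eq 0 fun x => by
    rw [← x.comp_mk₀_id, hY.eq_of_src (𝟙 _) 0, Ext.mk₀_zero, Ext.comp_zero]
  retract r hY i hi := subsingleton_of_forall_eq 0 fun x => by
    have := hY i hi
    rw [← x.comp_mk₀_id, ← r.retract, ← Ext.mk₀_comp_mk₀, ← Ext.comp_assoc_of_third_deg_zero,
      Subsingleton.elim (x.comp (Ext.mk₀ r.i) (add_zero i)) 0, Ext.zero_comp]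
  extension {S} hS h₁ h₃ i hi := subsingleton_of_forall_eq 0 fun x => by
    have := h₁ i hi
    have := h₃ i hi
    obtain ⟨y, rfl⟩ := Ext.covariant_sequence_exact₂ X hS x (Subsingleton.elim _ _)
    rw [Subsingleton.elim y 0, Ext.zero_comp]
  cokernel {S} hS h₁ h₂ i hi := subsingleton_of_forall_eq 0 fun x => by
    have := h₁ (i + 1) (by lia)
    have := h₂ i hi
    obtain ⟨y, rfl⟩ := Ext.covariant_sequence_exact₃ X hS x rfl (Subsingleton.elim _ _)
    rw [Subsingleton.elim y 0, Ext.zero_comp]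

variable {D : Type u₂} [Category.{v'} D] [Abelian D]

lemma CokernelClosed.inverseImage {Q : ObjectProperty D} (hQ : CokernelClosed Q) (F : C ⥤ D)
    [F.Additive] (hF : ∀ {S : ShortComplex C}, S.ShortExact → (S.map F).ShortExact) :
    CokernelClosed (Q.inverseImage F) where
  zero h := hQ.zero (F.map_isZero h)
  retract r h := hQ.retract (r.map F) h
  extension hS h₁ h₃ := hQ.extension (hF hS) h₁ h₃
  cokernel hS h₁ h₂ := hQ.cokernel (hF hS) h₁ h₂

/-! ### Derived functors of an adjunction -/

/-- `Ext^{n+1}(X, Y)` is the cohomology of `Hom(P, Y)`, for a projective resolution `P` of `X`. -/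
lemma subsingleton_ext_succ_iff [HasExt.{w} C] {X : C} (P : ProjectiveResolution X) (Y : C)
    (n : ℕ) : Subsingleton (Ext.{w} X Y (n + 1)) ↔
      ∀ f : P.complex.X (n + 1) ⟶ Y, P.complex.d (n + 2) (n + 1) ≫ f = 0 →
        ∃ g : P.complex.X n ⟶ Y, P.complex.d (n + 1) n ≫ g = f := by
  constructor
  · intro h f hf
    rw [← P.extMk_eq_zero_iff f (n + 2) rfl hf n rfl]
    exact Subsingleton.elim _ _
  · refine fun h => subsingleton_of_forall_eq 0 fun x => ?_
    obtain ⟨f, hf, rfl⟩ := P.extMk_surjective x (n + 2) rfl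
    exact (P.extMk_eq_zero_iff f (n + 2) rfl hf n rfl).2 (h f hf)

/-- An injective coseparator detects exactness. -/
lemma exact_iff_of_isCoseparator {E : C} [Injective E] (hE : IsCoseparator E)
    (S : ShortComplex C) :
    S.Exact ↔ ∀ f : S.X₂ ⟶ E, S.f ≫ f = 0 → ∃ g : S.X₃ ⟶ E, S.g ≫ g = f := by
  refine ⟨fun h f hf => ⟨h.descToInjective f hf, h.comp_descToInjective f hf⟩, fun h => ?_⟩
  rw [ShortComplex.exact_iff_iCycles_pOpcycles_zero]
  refine (isCoseparator_def _).1 hE _ _ fun φ => ?_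
  obtain ⟨g, hg⟩ := h (S.pOpcycles ≫ φ) (by simp)
  rw [Category.assoc, ← hg]
  simp

variable {G : C ⥤ D} [G.Additive] {H : D ⥤ C}

/-- The complexes `Hom(P, H E)` and `Hom(G P, E)` are isomorphic, so that they are exact in the same
places. -/
lemma forall_exists_map_iff (adj : G ⊣ H) {X₁ X₂ X₃ : C} (f : X₁ ⟶ X₂) (g : X₂ ⟶ X₃)
    (E : D) :
    (∀ φ : X₂ ⟶ H.obj E, f ≫ φ = 0 → ∃ ψ : X₃ ⟶ H.obj E, g ≫ ψ = φ) ↔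
      ∀ φ : G.obj X₂ ⟶ E, G.map f ≫ φ = 0 → ∃ ψ : G.obj X₃ ⟶ E, G.map g ≫ ψ = φ := by
  have h₀ : ∀ φ : G.obj X₂ ⟶ E, G.map f ≫ φ = 0 ↔ f ≫ adj.homEquiv _ _ φ = 0 := by
    intro φ
    rw [← adj.homEquiv_naturality_left]
    constructor
    · intro h
      rw [h, adj.homEquiv_unit]
      have := adj.right_adjoint_additive
      simp
    · intro h
      apply (adj.homEquiv _ _).injective
      have := adj.right_adjoint_additive
      rw [h, adj.homEquiv_unit]
      simp
  constructor
  · intro h φ hφ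
    obtain ⟨ψ, hψ⟩ := h (adj.homEquiv _ _ φ) ((h₀ φ).1 hφ)
    obtain ⟨ψ, rfl⟩ := (adj.homEquiv _ _).surjective ψ
    exact ⟨ψ, (adj.homEquiv _ _).injective (by rw [adj.homEquiv_naturality_left, hψ])⟩
  · intro h φ hφ
    obtain ⟨φ, rfl⟩ := (adj.homEquiv _ _).surjective φ
    obtain ⟨ψ, rfl⟩ := h φ ((h₀ φ).2 hφ)
    exact ⟨adj.homEquiv _ _ ψ, (adj.homEquiv_naturality_left _ _).symm⟩

lemma isZero_leftDerived_succ_iff {X : C} [HasProjectiveResolutions C]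
    (P : ProjectiveResolution X) (n : ℕ) :
    IsZero ((G.leftDerived (n + 1)).obj X) ↔
      (ShortComplex.mk (G.map (P.complex.d (n + 2) (n + 1))) (G.map (P.complex.d (n + 1) n))
        (by rw [← G.map_comp, P.complex.d_comp_d, G.map_zero])).Exact := by
  rw [(P.isoLeftDerivedObj G (n + 1)).isZero_iff]
  refine (HomologicalComplex.exactAt_iff_isZero_homology _ _).symm.trans ?_
  rw [HomologicalComplex.exactAt_iff' _ (n + 2) (n + 1) n (by simp) (by simp)]
  rfl

/-- The duality between `Ext` and `Tor`: the left derived functors of a left adjoint `G` vanish at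
`X` if and only if `Ext(X, H E)` does, for an injective coseparator `E`. -/
lemma forall_isZero_leftDerived_iff [HasExt.{w} C] [HasProjectiveResolutions C]
    (adj : G ⊣ H) {E : D} [Injective E] (hE : IsCoseparator E) (X : C) :
    (∀ i : ℕ, 1 ≤ i → IsZero ((G.leftDerived i).obj X)) ↔ rightPerp.{w} X (H.obj E) := by
  have P : ProjectiveResolution X := (HasProjectiveResolutions.out X).out.some
  have key : ∀ n : ℕ, IsZero ((G.leftDerived (n + 1)).obj X) ↔
      Subsingleton (Ext.{w} X (H.obj E) (n + 1)) := fun n => by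
    rw [isZero_leftDerived_succ_iff P, exact_iff_of_isCoseparator hE, subsingleton_ext_succ_iff P]
    exact (forall_exists_map_iff adj _ _ E).symm
  constructor
  · rintro h (_ | i) hi
    · lia
    · exact (key i).1 (h _ hi)
  · rintro h (_ | i) hi
    · lia
    · exact (key i).2 (h _ hi)

/-- If the left derived functors of a right exact functor `G` vanish at `X`, then `G` maps a
projective resolution of `X` to a projective resolution of `G X`. -/
def mapResolution [PreservesFiniteColimits G] [HasProjectiveResolutions C]
    (hG : ∀ P : C, Projective P → Projective (G.obj P)) {X : C}
    (hX : ∀ i : ℕ, 1 ≤ i → IsZero ((G.leftDerived i).obj X)) (P : ProjectiveResolution X) :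
    ProjectiveResolution (G.obj X) where
  complex := (G.mapHomologicalComplex _).obj P.complex
  projective n := hG _ (P.projective n)
  π := (ChainComplex.toSingle₀Equiv _ _).symm ⟨G.map (P.π.f 0),
    (G.map_comp _ _).symm.trans ((congrArg G.map P.complex_d_comp_π_f_zero).trans (G.map_zero _ _))⟩
  quasiIso := ⟨fun n => by
    cases n with
    | zero =>
      rw [ChainComplex.quasiIsoAt₀_iff, ShortComplex.quasiIso_iff_of_zeros' _
        (((G.mapHomologicalComplex _).obj P.complex).shape 0 0 (by simp)) rfl rfl]
      have h : (ShortComplex.mk (G.map (P.complex.d 1 0)) (G.map (P.π.f 0)) (by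
          rw [← G.map_comp, P.complex_d_comp_π_f_zero, G.map_zero])).Exact ∧
            Epi (G.map (P.π.f 0)) := by
        rw [ShortComplex.exact_and_epi_g_iff_g_is_cokernel]
        exact ⟨CokernelCofork.mapIsColimit _ (P.isColimitCokernelCofork) G⟩
      refine (ShortComplex.exact_and_epi_g_iff_of_iso ?_).2 h
      exact ShortComplex.isoMk (Iso.refl _) (Iso.refl _) (Iso.refl _)
        ((Category.id_comp _).trans (Category.comp_id _).symm)
        (by
          refine (Category.id_comp _).trans (Eq.trans ?_ (Category.comp_id _).symm)
          exact (ChainComplex.toSingle₀Equiv_symm_apply_f_zero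
            (C := (G.mapHomologicalComplex _).obj P.complex) (G.map (P.π.f 0)) _).symm)
    | succ n =>
      rw [quasiIsoAt_iff_exactAt' _ _ (ChainComplex.exactAt_succ_single_obj _ _),
        HomologicalComplex.exactAt_iff' _ (n + 2) (n + 1) n (by simp) (by simp)]
      exact (isZero_leftDerived_succ_iff P n).1 (hX _ (by lia))⟩

/-- If the left derived functors of the left adjoint `G` vanish at `X`, then `Ext(X, H T)` and
`Ext(G X, T)` vanish simultaneously. -/
lemma rightPerp_map_iff [HasExt.{w} C] [HasExt.{w} D] [HasProjectiveResolutions C]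
    (adj : G ⊣ H) (hG : ∀ P : C, Projective P → Projective (G.obj P)) {X : C}
    (hX : ∀ i : ℕ, 1 ≤ i → IsZero ((G.leftDerived i).obj X)) (T : D) :
    rightPerp.{w} X (H.obj T) ↔ rightPerp.{w} (G.obj X) T := by
  have := adj.leftAdjoint_preservesColimits
  have P : ProjectiveResolution X := (HasProjectiveResolutions.out X).out.some
  have key : ∀ n : ℕ, Subsingleton (Ext.{w} X (H.obj T) (n + 1)) ↔
      Subsingleton (Ext.{w} (G.obj X) T (n + 1)) := fun n => by
    rw [subsingleton_ext_succ_iff P, subsingleton_ext_succ_iff (mapResolution hG hX P)]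
    exact forall_exists_map_iff adj _ _ T
  constructor
  · rintro h (_ | i) hi
    · lia
    · exact (key i).1 (h _ hi)
  · rintro h (_ | i) hi
    · lia
    · exact (key i).2 (h _ hi)

end AbelianCategory

/-! ### Modules obtained from a given one by sums, summands and cokernels -/

section Modules

variable {R : Type u} [Ring R]

lemma shortExact_ofHom {X Y Z : Type u} [AddCommGroup X] [Module R X] [AddCommGroup Y] [Module R Y]
    [AddCommGroup Z] [Module R Z] {f : X →ₗ[R] Y} {g : Y →ₗ[R] Z} (hf : Function.Injective f)
    (hfg : Function.Exact f g) (hg : Function.Surjective g) :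
    (ShortComplex.mk (ModuleCat.ofHom f) (ModuleCat.ofHom g)
      (ModuleCat.hom_ext hfg.linearMap_comp_eq_zero)).ShortExact where
  exact := (ShortComplex.ShortExact.moduleCat_exact_iff_function_exact _).2 hfg
  mono_f := (ModuleCat.mono_iff_injective _).2 hf
  epi_g := (ModuleCat.epi_iff_surjective _).2 hg

variable {Q : ObjectProperty (ModuleCat.{u} R)}

lemma CokernelClosed.subsingleton (hQ : CokernelClosed Q) (X : ModuleCat.{u} R) [Subsingleton X] :
    Q X :=
  hQ.zero (ModuleCat.isZero_of_subsingleton X)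

lemma CokernelClosed.linearEquiv (hQ : CokernelClosed Q) {X Y : Type u} [AddCommGroup X]
    [Module R X] [AddCommGroup Y] [Module R Y] (e : X ≃ₗ[R] Y) (hX : Q (ModuleCat.of R X)) :
    Q (ModuleCat.of R Y) :=
  hQ.iso e.toModuleIso hX

lemma CokernelClosed.of_section (hQ : CokernelClosed Q) {X Y : Type u} [AddCommGroup X]
    [Module R X] [AddCommGroup Y] [Module R Y] (i : X →ₗ[R] Y) (r : Y →ₗ[R] X)
    (h : r ∘ₗ i = LinearMap.id) (hY : Q (ModuleCat.of R Y)) : Q (ModuleCat.of R X) :=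
  hQ.retract ⟨ModuleCat.ofHom i, ModuleCat.ofHom r, ModuleCat.hom_ext h⟩ hY

lemma CokernelClosed.pi (hQ : CokernelClosed Q) {T : Type u} [AddCommGroup T] [Module R T]
    (hT : Q (ModuleCat.of R T)) (n : ℕ) : Q (ModuleCat.of R (Fin n → T)) := by
  induction n with
  | zero => exact hQ.subsingleton _
  | succ n ih =>
    exact hQ.linearEquiv (Fin.consLinearEquiv R fun _ : Fin (n + 1) => T)
      (hQ.extension (shortExact_ofHom (f := LinearMap.inl R T (Fin n → T))
        LinearMap.inl_injective Function.Exact.inl_snd LinearMap.snd_surjective) hT ih)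

lemma CokernelClosed.addClosure (hQ : CokernelClosed Q) {T X : ModuleCat.{u} R} (hT : Q T)
    (hX : MonicModules.addClosure T X) : Q X := by
  obtain ⟨n, Y, ⟨e⟩⟩ := hX
  exact hQ.of_section (e.toLinearMap ∘ₗ LinearMap.inl R X Y) (LinearMap.fst R X Y ∘ₗ e.symm)
    (LinearMap.ext fun x => by simp) (hQ.pi (T := T) hT n)

lemma CokernelClosed.of_surjective (hQ : CokernelClosed Q) {X Y : Type u} [AddCommGroup X]
    [Module R X] [AddCommGroup Y] [Module R Y] {p : X →ₗ[R] Y} (hp : Function.Surjective p)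
    (hX : Q (ModuleCat.of R X)) (hK : Q (ModuleCat.of R (LinearMap.ker p))) :
    Q (ModuleCat.of R Y) :=
  hQ.cokernel (LinearMap.shortExact_shortComplexKer hp) hK hX

/-- The modules `range (d j)` lie in `Q`, by descending induction on `j`. -/
lemma CokernelClosed.of_hasFiniteAddResolution (hQ : CokernelClosed Q) {T M : ModuleCat.{u} R}
    (hT : Q T) (h : HasFiniteAddResolution T M) : Q M := by
  obtain ⟨m, P, d, ε, hP, hP', hε, hd₀, hd⟩ := h
  have hQP : ∀ j, Q (P j) := fun j => by
    by_cases hj : j ≤ m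
    · exact hQ.addClosure hT (hP j hj)
    · have := hP' j (not_le.1 hj)
      exact hQ.subsingleton _
  have hrange : ∀ n j, m ≤ j + n → Q (ModuleCat.of R (LinearMap.range (d j))) := by
    intro n
    induction n with
    | zero =>
      intro j hj
      have := hP' (j + 1) (by lia)
      have : Subsingleton (LinearMap.range (d j)) :=
        (LinearMap.surjective_rangeRestrict (d j)).subsingleton
      exact hQ.subsingleton _
    | succ n ih =>
      intro j hj
      refine hQ.of_surjective (LinearMap.surjective_rangeRestrict (d j)) (hQP (j + 1)) ?_
      rw [LinearMap.ker_rangeRestrict, LinearMap.exact_iff.1 (hd j)]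
      exact ih (j + 1) (by lia)
  refine hQ.of_surjective hε (hQP 0) ?_
  rw [LinearMap.exact_iff.1 hd₀]
  exact hrange m 0 (by lia)

/-- A class as in `CokernelClosed` which contains the regular module contains every finitely
generated module of finite projective dimension. -/
lemma CokernelClosed.of_hasProjectiveDimensionLT [IsNoetherianRing R] (hQ : CokernelClosed Q)
    (hR : Q (ModuleCat.of R R)) (n : ℕ) (M : Type u) [AddCommGroup M] [Module R M]
    [Module.Finite R M] [HasProjectiveDimensionLT (ModuleCat.of R M) n] :
    Q (ModuleCat.of R M) := by
  induction n generalizing M with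
  | zero => exact hQ.zero (isZero_of_hasProjectiveDimensionLT_zero _)
  | succ n ih =>
    obtain ⟨m, p, hp⟩ := Module.Finite.exists_fin' R M
    -- Syzygies do not lower the dimension of a projective module, which is a summand of `R ^ m`.
    rcases n with _ | n
    · have : Projective (ModuleCat.of R M) := inferInstance
      have : Module.Projective R M := (IsProjective.iff_projective M).2 this
      obtain ⟨s, hs⟩ := Module.projective_lifting_property p LinearMap.id hp
      exact hQ.of_section s p hs (hQ.pi hR m)
    · have hS := LinearMap.shortExact_shortComplexKer hp
      have : HasProjectiveDimensionLT (ModuleCat.of R (LinearMap.ker p)) (n + 1) :=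
        (hS.hasProjectiveDimensionLT_X₃_iff n
          (ModuleCat.projective_of_categoryTheory_projective (ModuleCat.of R (Fin m → R)))).1 ‹_›
      exact hQ.of_surjective hp (hQ.pi hR m) (ih _)

end Modules

/-! ### Duality over the ground field -/

section RightDual

variable (k M : Type u) [Field k] [AddCommGroup M] [Module k M]

/-- The dual `Hom_k(M, k)` of a left `A`-module `M`, to be regarded as a right `A`-module. -/
def RightDual : Type u := Module.Dual k M

instance : AddCommGroup (RightDual k M) := inferInstanceAs (AddCommGroup (Module.Dual k M))

instance : Module k (RightDual k M) := inferInstanceAs (Module k (Module.Dual k M))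

instance [Module.Finite k M] : Module.Finite k (RightDual k M) :=
  inferInstanceAs (Module.Finite k (Module.Dual k M))

instance : Module k (DualModule k M) := inferInstanceAs (Module k (Module.Dual k M))

instance [Module.Finite k M] : Module.Finite k (DualModule k M) :=
  inferInstanceAs (Module.Finite k (Module.Dual k M))

section

variable (A : Type u) [Ring A] [Algebra k A] [Module A M] [IsScalarTower k A M]

/-- The action `(f a) x = f (a x)`. -/
instance : Module Aᵐᵒᵖ (RightDual k M) where
  smul a f := LinearMap.comp (show M →ₗ[k] k from f) (Algebra.lsmul k k M (unop a))
  one_smul f := LinearMap.ext fun x => congrArg (show M →ₗ[k] k from f) (one_smul A x)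
  mul_smul a b f := LinearMap.ext fun x =>
    congrArg (show M →ₗ[k] k from f) (mul_smul (unop b) (unop a) x)
  smul_zero _ := rfl
  smul_add _ _ _ := rfl
  add_smul a b f := LinearMap.ext fun x =>
    (congrArg (show M →ₗ[k] k from f) (add_smul (unop a) (unop b) x)).trans
      (map_add (show M →ₗ[k] k from f) (unop a • x) (unop b • x))
  zero_smul f := LinearMap.ext fun x =>
    (congrArg (show M →ₗ[k] k from f) (zero_smul A x)).trans
      (map_zero (show M →ₗ[k] k from f))

variable {k M A}

instance : IsScalarTower k Aᵐᵒᵖ (RightDual k M) where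
  smul_assoc c a f := LinearMap.ext fun x => by
    change (show Module.Dual k M from f) ((c • unop a) • x) =
      c • (show Module.Dual k M from f) (unop a • x)
    rw [smul_assoc, map_smul]

/-- The transpose of an `A`-linear map. -/
def RightDual.map {N : Type u} [AddCommGroup N] [Module k N] [Module A N] [IsScalarTower k A N]
    (f : M →ₗ[A] N) : RightDual k N →ₗ[Aᵐᵒᵖ] RightDual k M where
  toFun g := (show Module.Dual k N from g) ∘ₗ f.restrictScalars k
  map_add' _ _ := rfl
  map_smul' a g := LinearMap.ext fun x =>
    congrArg (show Module.Dual k N from g) (f.map_smul (unop a) x).symm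

end

section

variable (A : Type u) [Ring A] [Algebra k A] [Module Aᵐᵒᵖ M] [IsScalarTower k Aᵐᵒᵖ M]

instance : IsScalarTower k A (DualModule k M) where
  smul_assoc c a f := LinearMap.ext fun x => by
    change (show Module.Dual k M from f) ((c • op a) • x) =
      c • (show Module.Dual k M from f) (op a • x)
    rw [smul_assoc, map_smul]

end

end RightDual

section Duality

variable {k : Type u} [Field k] {A : Type u} [Ring A] [Algebra k A]

section

variable {F Y Z : Type u} [AddCommGroup F] [Module k F] [Module A F] [IsScalarTower k A F]
  [AddCommGroup Y] [Module k Y] [Module Aᵐᵒᵖ Y] [IsScalarTower k Aᵐᵒᵖ Y]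
  [AddCommGroup Z] [Module k Z] [Module Aᵐᵒᵖ Z] [IsScalarTower k Aᵐᵒᵖ Z]

/-- The transpose of an `A`-linear map into the dual of a right module. -/
def transposeRight (g : F →ₗ[A] DualModule k Y) : Y →ₗ[Aᵐᵒᵖ] RightDual k F where
  toFun y :=
    { toFun x := (show Module.Dual k Y from g x) y
      map_add' x x' := by rw [map_add]; rfl
      map_smul' c x := by rw [LinearMap.map_smul_of_tower]; rfl }
  map_add' y y' := LinearMap.ext fun x => (show Module.Dual k Y from g x).map_add y y'
  map_smul' a y := LinearMap.ext fun x => by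
    change (show Module.Dual k Y from g x) (a • y) =
      (show Module.Dual k Y from g (unop a • x)) y
    rw [g.map_smul]
    rfl

/-- The transpose of an `Aᵐᵒᵖ`-linear map into the dual of a left module. -/
def transposeLeft (g : Y →ₗ[Aᵐᵒᵖ] RightDual k F) : F →ₗ[A] DualModule k Y where
  toFun x :=
    { toFun y := (show Module.Dual k F from g y) x
      map_add' y y' := by rw [map_add]; rfl
      map_smul' c y := by rw [LinearMap.map_smul_of_tower]; rfl }
  map_add' x x' := LinearMap.ext fun y => (show Module.Dual k F from g y).map_add x x'
  map_smul' a x := LinearMap.ext fun y => by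
    change (show Module.Dual k F from g y) (a • x) =
      (show Module.Dual k F from g (op a • y)) x
    rw [g.map_smul]
    rfl

/-- The transpose of a linear map of right modules. -/
def DualModule.map (f : Y →ₗ[Aᵐᵒᵖ] Z) : DualModule k Z →ₗ[A] DualModule k Y where
  toFun g := (show Module.Dual k Z from g) ∘ₗ f.restrictScalars k
  map_add' _ _ := rfl
  map_smul' a g := LinearMap.ext fun x =>
    congrArg (show Module.Dual k Z from g) (f.map_smul (op a) x).symm

lemma DualModule.map_surjective (f : Y →ₗ[Aᵐᵒᵖ] Z) (hf : Function.Injective f) :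
    Function.Surjective (DualModule.map (k := k) f) :=
  LinearMap.dualMap_surjective_of_injective (f := f.restrictScalars k) hf

/-- A map `Y → D(F)` is the transpose of a map `F → D(Y)`, which lifts along `D(Z) → D(Y)` when
`F` is projective. -/
lemma exists_extension_rightDual [Module.Projective A F] (f : Y →ₗ[Aᵐᵒᵖ] Z)
    (hf : Function.Injective f) (g : Y →ₗ[Aᵐᵒᵖ] RightDual k F) :
    ∃ h : Z →ₗ[Aᵐᵒᵖ] RightDual k F, h ∘ₗ f = g := by
  obtain ⟨h, hh⟩ := Module.projective_lifting_property (DualModule.map (k := k) f)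
    (transposeLeft g) (DualModule.map_surjective f hf)
  refine ⟨transposeRight h, LinearMap.ext fun y => LinearMap.ext fun x => ?_⟩
  exact congrArg (fun φ : Module.Dual k Y => φ y) (LinearMap.congr_fun hh x)

end

/-- The dual of a projective module is injective. -/
lemma injective_rightDual (F : Type u) [AddCommGroup F] [Module k F] [Module A F]
    [IsScalarTower k A F] [Module.Projective A F] :
    Injective (ModuleCat.of Aᵐᵒᵖ (RightDual k F)) where
  factors {Y Z} g f hf := by
    let : Module k Y := Module.restrictScalars k Aᵐᵒᵖ Y
    have : IsScalarTower k Aᵐᵒᵖ Y := IsScalarTower.restrictScalars k Aᵐᵒᵖ Y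
    let : Module k Z := Module.restrictScalars k Aᵐᵒᵖ Z
    have : IsScalarTower k Aᵐᵒᵖ Z := IsScalarTower.restrictScalars k Aᵐᵒᵖ Z
    obtain ⟨h, hh⟩ := exists_extension_rightDual f.hom ((ModuleCat.mono_iff_injective f).1 hf) g.hom
    exact ⟨ModuleCat.ofHom h, ModuleCat.hom_ext hh⟩

section

variable {M F : Type u} [AddCommGroup M] [Module k M] [Module A M] [IsScalarTower k A M]
  [AddCommGroup F] [Module k F] [Module A F] [IsScalarTower k A F]

/-- The dual of the short exact sequence `0 → ker p → F → M → 0` is exact. -/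
lemma shortExact_rightDual {p : F →ₗ[A] M} (hp : Function.Surjective p) :
    Function.Injective (RightDual.map (k := k) p) ∧
      Function.Exact (RightDual.map (k := k) p)
        (RightDual.map (k := k) (LinearMap.ker p).subtype) ∧
      Function.Surjective (RightDual.map (k := k) (LinearMap.ker p).subtype) := by
  refine ⟨LinearMap.dualMap_injective_of_surjective (f := p.restrictScalars k) hp, ?_,
    LinearMap.dualMap_surjective_of_injective
      (f := (LinearMap.ker p).subtype.restrictScalars k) Subtype.val_injective⟩
  intro φ
  constructor
  · intro h
    have hφ : (show Module.Dual k F from φ) ∈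
        (LinearMap.ker (p.restrictScalars k)).dualAnnihilator :=
      (Submodule.mem_dualAnnihilator _).2 fun x hx => LinearMap.congr_fun
        (show (show Module.Dual k F from φ) ∘ₗ (LinearMap.ker p).subtype.restrictScalars k = 0
          from h) ⟨x, hx⟩
    rwa [← LinearMap.range_dualMap_eq_dualAnnihilator_ker] at hφ
  · rintro ⟨ψ, rfl⟩
    refine LinearMap.ext fun x => ?_
    change (show M →ₗ[k] k from ψ) (p x.1) = 0
    rw [show p x.1 = 0 from x.2, map_zero]

/-- A surjection onto a finite-dimensional module with injective dual splits. -/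
lemma exists_section_of_injective_rightDual [Module.Finite k F] [Module.Finite k M]
    [Injective (ModuleCat.of Aᵐᵒᵖ (RightDual k M))] {p : F →ₗ[A] M}
    (hp : Function.Surjective p) : ∃ s : M →ₗ[A] F, p ∘ₗ s = LinearMap.id := by
  have : Mono (ModuleCat.ofHom (RightDual.map (k := k) p)) :=
    (ModuleCat.mono_iff_injective _).2 (shortExact_rightDual hp).1
  let r : RightDual k F →ₗ[Aᵐᵒᵖ] RightDual k M := (Injective.factorThru
    (𝟙 (ModuleCat.of Aᵐᵒᵖ (RightDual k M))) (ModuleCat.ofHom (RightDual.map (k := k) p))).hom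
  have hr : ∀ φ, r (RightDual.map (k := k) p φ) = φ := fun φ =>
    congrArg (fun f => f.hom φ) (Injective.comp_factorThru
      (𝟙 (ModuleCat.of Aᵐᵒᵖ (RightDual k M))) (ModuleCat.ofHom (RightDual.map (k := k) p)))
  -- The section is the transpose of the retraction `r`, through `F ≅ D D F` and `M ≅ D D M`.
  let s₀ : M →ₗ[k] F := (Module.evalEquiv k F).symm.toLinearMap ∘ₗ
    LinearMap.dualMap (r.restrictScalars k) ∘ₗ Module.Dual.eval k M
  have hs₀ : ∀ (m : M) (φ : Module.Dual k F),
      φ (s₀ m) = (show Module.Dual k M from r φ) m := fun m φ =>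
    Module.apply_evalEquiv_symm_apply k F φ _
  have hext : ∀ x y : F, (∀ φ : Module.Dual k F, φ x = φ y) → x = y := fun x y h =>
    sub_eq_zero.1 ((Module.forall_dual_apply_eq_zero_iff k _).1 fun φ => by
      rw [map_sub, h, sub_self])
  refine ⟨{ s₀ with map_smul' := fun a m => hext _ _ fun φ => ?_ }, LinearMap.ext fun m =>
    sub_eq_zero.1 ((Module.forall_dual_apply_eq_zero_iff k _).1 fun φ => ?_)⟩
  · calc φ (s₀ (a • m)) = (show Module.Dual k M from op a • r φ) m := hs₀ _ _
      _ = (show Module.Dual k M from r (op a • (show RightDual k F from φ))) m := by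
        rw [r.map_smul]
      _ = φ (a • s₀ m) := (hs₀ m _).symm
  · change φ (p (s₀ m) - m) = 0
    rw [map_sub, sub_eq_zero]
    refine (hs₀ m (φ ∘ₗ p.restrictScalars k)).trans ?_
    exact congrArg (fun ψ : Module.Dual k M => ψ m) (hr φ)

/-- A class as in `CokernelClosed` which contains `A` contains every finite-dimensional module whose
dual has finite injective dimension. -/
lemma CokernelClosed.of_hasInjectiveDimensionLT_rightDual [Module.Finite k A]
    {Q : ObjectProperty (ModuleCat.{u} A)} (hQ : CokernelClosed Q) (hA : Q (ModuleCat.of A A))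
    (n : ℕ) (M : Type u) [AddCommGroup M] [Module k M] [Module A M] [IsScalarTower k A M]
    [Module.Finite k M] [HasInjectiveDimensionLT (ModuleCat.of Aᵐᵒᵖ (RightDual k M)) n] :
    Q (ModuleCat.of A M) := by
  induction n generalizing M with
  | zero =>
    have h := isZero_of_hasInjectiveDimensionLT_zero (ModuleCat.of Aᵐᵒᵖ (RightDual k M))
    have : Subsingleton (Module.Dual k M) := ModuleCat.subsingleton_of_isZero h
    have : Subsingleton M := ⟨fun x y => sub_eq_zero.1
      ((Module.forall_dual_apply_eq_zero_iff k _).1 fun φ => by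
        rw [Subsingleton.elim φ 0, LinearMap.zero_apply])⟩
    exact hQ.subsingleton _
  | succ n ih =>
    have : Module.Finite A M := Module.Finite.of_restrictScalars_finite k A M
    obtain ⟨m, p, hp⟩ := Module.Finite.exists_fin' A M
    -- If the dual of `M` is injective, then `M` is a summand of `A ^ m`.
    rcases n with _ | n
    · have : Injective (ModuleCat.of Aᵐᵒᵖ (RightDual k M)) := inferInstance
      obtain ⟨s, hs⟩ := exists_section_of_injective_rightDual (k := k) hp
      exact hQ.of_section s p hs (hQ.pi hA m)
    · obtain ⟨h₁, h₂, h₃⟩ := shortExact_rightDual (k := k) hp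
      have : HasInjectiveDimensionLT
          (ModuleCat.of Aᵐᵒᵖ (RightDual k (LinearMap.ker p))) (n + 1) :=
        ((shortExact_ofHom h₁ h₂ h₃).hasInjectiveDimensionLT_X₃_iff n
          (injective_rightDual (Fin m → A))).2 ‹_›
      have : Module.Finite k (LinearMap.ker p) :=
        inferInstanceAs (Module.Finite k ((LinearMap.ker p).restrictScalars k))
      exact hQ.of_surjective hp (hQ.pi hA m) (ih _)

end

variable (k A)

/-- The `A`-linear map `x ↦ (a ↦ φ (a x))` to `D(A_A)` attached to a linear form `φ` on `N`. All
`A`-linear maps to `D(A_A)` are of this form. -/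
def homDualModule {N : Type u} [AddCommGroup N] [Module k N] [Module A N] [IsScalarTower k A N]
    (φ : N →ₗ[k] k) : N →ₗ[A] DualModule k A where
  toFun x := φ ∘ₗ (LinearMap.toSpanSingleton A N x).restrictScalars k
  map_add' x y := LinearMap.ext fun a => by
    change φ (a • (x + y)) = φ (a • x) + φ (a • y)
    rw [smul_add, map_add]
  map_smul' b x := LinearMap.ext fun a => congrArg φ (mul_smul a b x).symm

instance injective_dualModule : Injective (ModuleCat.of A (DualModule k A)) where
  factors {Y Z} g f hf := by
    let : Module k Y := Module.restrictScalars k A Y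
    have : IsScalarTower k A Y := IsScalarTower.restrictScalars k A Y
    let : Module k Z := Module.restrictScalars k A Z
    have : IsScalarTower k A Z := IsScalarTower.restrictScalars k A Z
    let g₀ : Y →ₗ[k] k :=
      Module.Dual.eval k A 1 ∘ₗ (show Y →ₗ[k] Module.Dual k A from g.hom.restrictScalars k)
    obtain ⟨φ, hφ⟩ := LinearMap.dualMap_surjective_of_injective (f := f.hom.restrictScalars k)
      ((ModuleCat.mono_iff_injective f).1 hf) g₀
    refine ⟨ModuleCat.ofHom (homDualModule k A φ), ModuleCat.hom_ext <| LinearMap.ext fun y =>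
      LinearMap.ext fun a => ?_⟩
    calc φ (a • f.hom y) = φ (f.hom (a • y)) := by rw [f.hom.map_smul]
      _ = (show Module.Dual k A from g.hom (a • y)) 1 := LinearMap.congr_fun hφ (a • y)
      _ = (show Module.Dual k A from g.hom y) (1 * a) := by rw [g.hom.map_smul]; rfl
      _ = _ := by rw [one_mul]

/-- The module `D(A_A)` is an injective cogenerator. -/
lemma isCoseparator_dualModule : IsCoseparator (ModuleCat.of A (DualModule k A)) := by
  refine (isCoseparator_def _).2 fun X Y f g h => ModuleCat.hom_ext <| LinearMap.ext fun x => ?_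
  let : Module k Y := Module.restrictScalars k A Y
  have : IsScalarTower k A Y := IsScalarTower.restrictScalars k A Y
  refine sub_eq_zero.1 ((Module.forall_dual_apply_eq_zero_iff k _).1 fun φ => ?_)
  have := congrArg (fun ψ => (show Module.Dual k A from ψ.hom x) 1)
    (h (ModuleCat.ofHom (homDualModule k A φ)))
  change φ ((1 : A) • f.hom x) = φ ((1 : A) • g.hom x) at this
  rw [map_sub, sub_eq_zero, ← one_smul A (f.hom x), this, one_smul]

/-- The double dual `D(D(M))` of a finite-dimensional module. -/
def evalRightDual (M : Type u) [AddCommGroup M] [Module k M] [Module A M] [IsScalarTower k A M]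
    [Module.Finite k M] : M ≃ₗ[A] DualModule k (RightDual k M) :=
  { Module.evalEquiv k M with
    map_smul' := fun _ _ => rfl }

/-- The double dual `D(D(A_A))` of the regular right module. -/
def evalDualModule [Module.Finite k A] : A ≃ₗ[Aᵐᵒᵖ] RightDual k (DualModule k A) :=
  { Module.evalEquiv k A with
    map_smul' := fun _ _ => rfl }

end Duality

/-! ### The right adjoint of the tensor product with a bimodule -/

section HomModule

variable (S R M : Type u) [Ring S] [Ring R] [AddCommGroup M] [Module S M] [Module Rᵐᵒᵖ M]

/-- The group `Hom_S(M, T)`, for an `S`-`R`-bimodule `M` and a left `S`-module `T`, to be regarded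
as a left `R`-module. -/
def HomModule (T : Type u) [AddCommGroup T] [Module S T] : Type u := M →ₗ[S] T

instance (T : Type u) [AddCommGroup T] [Module S T] : AddCommGroup (HomModule S M T) :=
  inferInstanceAs (AddCommGroup (M →ₗ[S] T))

variable {S R M} in
lemma BalancedTensor.mk_smul_tmul {X : Type u} [AddCommGroup X] [Module R X] (m : M) (r : R)
    (x : X) : (Submodule.Quotient.mk ((op r • m) ⊗ₜ[ℤ] x) : BalancedTensor S R M X) =
      Submodule.Quotient.mk (m ⊗ₜ[ℤ] (r • x)) :=
  (Submodule.Quotient.eq _).2 (Submodule.subset_span ⟨m, r, x, rfl⟩)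

variable [SMulCommClass S Rᵐᵒᵖ M]

/-- The action `(r f) m = f (m r)`. -/
instance (T : Type u) [AddCommGroup T] [Module S T] : Module R (HomModule S M T) where
  smul r f := (show M →ₗ[S] T from f) ∘ₗ
    { toFun m := op r • m
      map_add' := smul_add (op r)
      map_smul' s m := (smul_comm s (op r) m).symm }
  one_smul f := LinearMap.ext fun m => congrArg (show M →ₗ[S] T from f) (one_smul Rᵐᵒᵖ m)
  mul_smul a b f := LinearMap.ext fun m =>
    congrArg (show M →ₗ[S] T from f) (mul_smul (op b) (op a) m)
  smul_zero _ := rfl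
  smul_add _ _ _ := rfl
  add_smul a b f := LinearMap.ext fun m =>
    (congrArg (show M →ₗ[S] T from f) (add_smul (op a) (op b) m)).trans
      ((show M →ₗ[S] T from f).map_add (op a • m) (op b • m))
  zero_smul f := LinearMap.ext fun m =>
    (congrArg (show M →ₗ[S] T from f) (zero_smul Rᵐᵒᵖ m)).trans (show M →ₗ[S] T from f).map_zero

/-- The functor `Hom_S(M, -) : S-Mod ⥤ R-Mod`, for an `S`-`R`-bimodule `M`. -/
def homFunctor : ModuleCat.{u} S ⥤ ModuleCat.{u} R where
  obj T := ModuleCat.of R (HomModule S M T)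
  map f := ModuleCat.ofHom
    { toFun g := f.hom ∘ₗ (show M →ₗ[S] _ from g)
      map_add' g h := LinearMap.comp_add (show M →ₗ[S] _ from g) (show M →ₗ[S] _ from h) f.hom
      map_smul' _ _ := rfl }
  map_id _ := rfl
  map_comp _ _ := rfl

instance homFunctor_additive : (homFunctor S R M).Additive where
  map_add := rfl

variable {S R M} in
/-- The map `X → Hom_S(M, T)`, `x ↦ (m ↦ f (m ⊗ x))`, attached to `f : M ⊗_R X → T`. -/
def BalancedTensor.curry {X T : Type u} [AddCommGroup X] [Module R X] [AddCommGroup T] [Module S T]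
    (f : BalancedTensor S R M X →ₗ[S] T) : X →ₗ[R] HomModule S M T where
  toFun x :=
    { toFun m := f (Submodule.Quotient.mk (m ⊗ₜ[ℤ] x))
      map_add' m m' := by rw [TensorProduct.add_tmul, Submodule.Quotient.mk_add, f.map_add]
      map_smul' s m := f.map_smul s (Submodule.Quotient.mk (m ⊗ₜ[ℤ] x)) }
  map_add' x y := LinearMap.ext fun m => by
    change f (Submodule.Quotient.mk (m ⊗ₜ[ℤ] (x + y))) = _
    rw [TensorProduct.tmul_add, Submodule.Quotient.mk_add, f.map_add]
    rfl
  map_smul' r x := LinearMap.ext fun m => congrArg f (mk_smul_tmul m r x).symm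

variable {S R M} in
/-- The map `M ⊗_R X → T`, `m ⊗ x ↦ (f x) m`, attached to `f : X → Hom_S(M, T)`. -/
def BalancedTensor.lift {X T : Type u} [AddCommGroup X] [Module R X] [AddCommGroup T] [Module S T]
    (f : X →ₗ[R] HomModule S M T) : BalancedTensor S R M X →ₗ[S] T :=
  (balancedRel S R M X).liftQ
    (TensorProduct.AlgebraTensorModule.lift
      { toFun m :=
          { toFun x := (show M →ₗ[S] T from f x) m
            map_add' x y := by rw [f.map_add]; rfl
            map_smul' c x := by rw [map_zsmul]; rfl }
        map_add' m m' := LinearMap.ext fun x => (show M →ₗ[S] T from f x).map_add m m'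
        map_smul' s m := LinearMap.ext fun x => (show M →ₗ[S] T from f x).map_smul s m }) <| by
    rw [balancedRel, Submodule.span_le]
    rintro _ ⟨m, r, x, rfl⟩
    refine LinearMap.mem_ker.2 ((map_sub _ _ _).trans ?_)
    change (show M →ₗ[S] T from f x) (op r • m) - (show M →ₗ[S] T from f (r • x)) m = 0
    rw [f.map_smul, sub_eq_zero]
    rfl

/-- The tensor-hom adjunction for a bimodule. -/
def tensorHomAdjunction : tensorFunctor S R M ⊣ homFunctor S R M :=
  Adjunction.mkOfHomEquiv
    { homEquiv _ _ :=
        { toFun f := ModuleCat.ofHom (BalancedTensor.curry f.hom)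
          invFun f := ModuleCat.ofHom (BalancedTensor.lift f.hom)
          left_inv _ := ModuleCat.hom_ext (BalancedTensor.hom_ext fun _ _ => rfl)
          right_inv _ := rfl }
      homEquiv_naturality_left_symm _ _ :=
        ModuleCat.hom_ext (BalancedTensor.hom_ext fun _ _ => rfl)
      homEquiv_naturality_right _ _ := rfl }

lemma shortExact_homFunctor [Module.Projective S M] {C : ShortComplex (ModuleCat.{u} S)}
    (hC : C.ShortExact) : (C.map (homFunctor S R M)).ShortExact where
  exact := (ShortComplex.ShortExact.moduleCat_exact_iff_function_exact _).2 fun f => by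
    have hex := (ShortComplex.ShortExact.moduleCat_exact_iff_function_exact _).1 hC.exact
    constructor
    · intro h
      have h' : ∀ m, C.g.hom ((show M →ₗ[S] C.X₂ from f) m) = 0 := fun m => LinearMap.congr_fun h m
      choose g hg using fun m => (hex _).1 (h' m)
      have hinj := hC.moduleCat_injective_f
      let g' : M →ₗ[S] C.X₁ :=
        { toFun := g
          map_add' x y := hinj <| by
            rw [hg, map_add, map_add]
            exact congrArg₂ _ (hg x).symm (hg y).symm
          map_smul' s x := hinj <| by
            rw [hg, map_smul, RingHom.id_apply]
            exact ((C.f.hom.map_smul s _).trans (congrArg _ (hg x))).symm }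
      exact ⟨g', LinearMap.ext hg⟩
    · rintro ⟨g, rfl⟩
      exact LinearMap.ext fun m => hex.apply_apply_eq_zero ((show M →ₗ[S] C.X₁ from g) m)
  mono_f := (ModuleCat.mono_iff_injective _).2 fun f g h => LinearMap.ext fun m =>
    hC.moduleCat_injective_f (LinearMap.congr_fun h m)
  epi_g := (ModuleCat.epi_iff_surjective _).2 fun f =>
    Module.projective_lifting_property C.g.hom (show M →ₗ[S] C.X₃ from f) hC.moduleCat_surjective_g

lemma projective_tensorFunctor [Module.Projective S M] (P : ModuleCat.{u} R) (hP : Projective P) :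
    Projective ((tensorFunctor S R M).obj P) := by
  have : (homFunctor S R M).PreservesEpimorphisms := ⟨fun {T T'} f hf => by
    rw [ModuleCat.epi_iff_surjective] at hf ⊢
    exact fun g => Module.projective_lifting_property f.hom (show M →ₗ[S] T' from g) hf⟩
  exact (tensorHomAdjunction S R M).map_projective P hP

lemma finite_tensorFunctor [Module.Finite S M] (X : ModuleCat.{u} R) [Module.Finite R X] :
    Module.Finite S ((tensorFunctor S R M).obj X) := by
  obtain ⟨s, hs⟩ := Module.Finite.fg_top (R := S) (M := M)
  obtain ⟨t, ht⟩ := Module.Finite.fg_top (R := R) (M := X)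
  classical
  let mk : M → X → BalancedTensor S R M X := fun m x => Submodule.Quotient.mk (m ⊗ₜ[ℤ] x)
  let N : Submodule S (BalancedTensor S R M X) :=
    Submodule.span S ((s ×ˢ t).image fun z => mk z.1 z.2 : Finset _)
  have h₁ : ∀ x ∈ t, ∀ m, mk m x ∈ N := by
    intro x hx m
    have hm : m ∈ Submodule.span S (s : Set M) := hs ▸ Submodule.mem_top
    induction hm using Submodule.span_induction with
    | mem m hm =>
      exact Submodule.subset_span (Finset.mem_coe.2 (Finset.mem_image.2
        ⟨(m, x), Finset.mem_product.2 ⟨hm, hx⟩, rfl⟩))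
    | zero =>
      have : mk 0 x = 0 := by simp only [mk, TensorProduct.zero_tmul, Submodule.Quotient.mk_zero]
      rw [this]
      exact N.zero_mem
    | add a b _ _ ha hb =>
      have : mk (a + b) x = mk a x + mk b x := by
        simp only [mk, TensorProduct.add_tmul, Submodule.Quotient.mk_add]
      rw [this]
      exact N.add_mem ha hb
    | smul c a _ ha => exact N.smul_mem c ha
  have h₂ : ∀ x m, mk m x ∈ N := by
    intro x
    have hx : x ∈ Submodule.span R (t : Set X) := ht ▸ Submodule.mem_top
    induction hx using Submodule.span_induction with
    | mem x hx => exact h₁ x hx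
    | zero =>
      intro m
      have : mk m 0 = 0 := by simp only [mk, TensorProduct.tmul_zero, Submodule.Quotient.mk_zero]
      rw [this]
      exact N.zero_mem
    | add a b _ _ ha hb =>
      intro m
      have : mk m (a + b) = mk m a + mk m b := by
        simp only [mk, TensorProduct.tmul_add, Submodule.Quotient.mk_add]
      rw [this]
      exact N.add_mem (ha m) (hb m)
    | smul r a _ ha =>
      intro m
      have : mk m (r • a) = mk (op r • m) a :=
        (BalancedTensor.mk_smul_tmul m r a).symm
      rw [this]
      exact ha _
  refine ⟨⟨_, eq_top_iff.2 fun z _ => (?_ : z ∈ N)⟩⟩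
  obtain ⟨z, rfl⟩ := Submodule.Quotient.mk_surjective _ z
  clear * -h₂
  induction z using TensorProduct.induction_on with
  | zero => exact N.zero_mem
  | tmul m x => exact h₂ x m
  | add a b ha hb => exact N.add_mem ha hb

end HomModule

/-! ### Outer tensor products -/

section Outer

variable {k A B : Type u} [Field k] [Ring A] [Algebra k A] [Ring B] [Algebra k B]

section

variable {M N : Type u} [AddCommGroup M] [Module k M] [Module A M] [IsScalarTower k A M]
  [AddCommGroup N] [Module k N] [Module B N] [IsScalarTower k B N]

/-- An additive map on `M ⊗ N` is `A ⊗ B`-linear if it is so on pure tensors. -/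
def OuterTensor.linearMap {Y : Type u} [AddCommGroup Y] [Module (A ⊗[k] B) Y]
    (f : M ⊗[k] N →+ Y)
    (hf : ∀ (a : A) (b : B) (m : M) (n : N),
      f ((a • m) ⊗ₜ[k] (b • n)) = (a ⊗ₜ[k] b) • f (m ⊗ₜ[k] n)) :
    OuterTensor k M N →ₗ[A ⊗[k] B] Y where
  toFun := f
  map_add' := f.map_add
  map_smul' r := by
    change ∀ z : M ⊗[k] N, f (outerAction k A B M N r z) = r • f z
    intro z
    induction r using TensorProduct.induction_on with
    | zero => rw [map_zero, LinearMap.zero_apply, map_zero, zero_smul]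
    | add r s hr hs => rw [map_add, LinearMap.add_apply, map_add, hr, hs, add_smul]
    | tmul a b =>
      induction z using TensorProduct.induction_on with
      | zero => simp only [map_zero, smul_zero]
      | tmul m n => exact hf a b m n
      | add x y hx hy => simp only [map_add, smul_add, hx, hy]

/-- The tensor product of an `A`-linear and a `B`-linear map. -/
def OuterTensor.map {M' N' : Type u} [AddCommGroup M'] [Module k M'] [Module A M']
    [IsScalarTower k A M'] [AddCommGroup N'] [Module k N'] [Module B N'] [IsScalarTower k B N']
    (f : M →ₗ[A] M') (g : N →ₗ[B] N') :
    OuterTensor k M N →ₗ[A ⊗[k] B] OuterTensor k M' N' :=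
  OuterTensor.linearMap
    (TensorProduct.map (f.restrictScalars k) (g.restrictScalars k)).toAddMonoidHom
    fun a b m n => by
      change f (a • m) ⊗ₜ[k] g (b • n) = (a • f m) ⊗ₜ[k] (b • g n)
      rw [map_smul, map_smul]

/-- The tensor product of an `A`-linear and a `B`-linear equivalence. -/
def OuterTensor.congr {M' N' : Type u} [AddCommGroup M'] [Module k M'] [Module A M']
    [IsScalarTower k A M'] [AddCommGroup N'] [Module k N'] [Module B N'] [IsScalarTower k B N']
    (e : M ≃ₗ[A] M') (e' : N ≃ₗ[B] N') :
    OuterTensor k M N ≃ₗ[A ⊗[k] B] OuterTensor k M' N' :=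
  LinearEquiv.ofBijective (OuterTensor.map e.toLinearMap e'.toLinearMap)
    (TensorProduct.congr (e.restrictScalars k) (e'.restrictScalars k)).bijective

variable (k A B) in
/-- The regular module of `A ⊗ B` is the tensor product of the regular modules. -/
def outerRegular : OuterTensor k A B ≃ₗ[A ⊗[k] B] A ⊗[k] B :=
  LinearEquiv.ofBijective (OuterTensor.linearMap (AddMonoidHom.id (A ⊗[k] B))
    fun a b m n => (Algebra.TensorProduct.tmul_mul_tmul a m b n).symm) Function.bijective_id

end

variable (k A B) in
open scoped ModuleCat in
/-- The functor `T ⊗_k - : B-Mod ⥤ (A ⊗ B)-Mod`, where `k` acts on a `B`-module through `k → B`. -/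
def outerFunctor (T : Type u) [AddCommGroup T] [Module k T] [Module A T] [IsScalarTower k A T] :
    ModuleCat.{u} B ⥤ ModuleCat.{u} (A ⊗[k] B) where
  obj W := ModuleCat.of (A ⊗[k] B) (OuterTensor k T W)
  map f := ModuleCat.ofHom (OuterTensor.map LinearMap.id f.hom)
  map_id W := ModuleCat.hom_ext <| LinearMap.ext fun z =>
    LinearMap.congr_fun (TensorProduct.map_id (R := k) (M := T) (N := W)) z
  map_comp f g := ModuleCat.hom_ext <| LinearMap.ext fun z =>
    LinearMap.congr_fun (LinearMap.lTensor_comp T (g.hom.restrictScalars k)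
      (f.hom.restrictScalars k)) z

section

variable (T : Type u) [AddCommGroup T] [Module k T] [Module A T] [IsScalarTower k A T]

open scoped ModuleCat in
instance outerFunctor_additive : (outerFunctor k A B T).Additive where
  map_add {_ _ f g} := ModuleCat.hom_ext <| LinearMap.ext fun z =>
    LinearMap.congr_fun (LinearMap.lTensor_add T (f.hom.restrictScalars k)
      (g.hom.restrictScalars k)) z

variable {T} in
open scoped ModuleCat in
/-- The value of `outerFunctor` is the outer tensor product for any compatible `k`-module structure
on the argument, not only for the one obtained by restriction of scalars from `B`. -/
def outerFunctorObjIso {N : Type u} [AddCommGroup N] [Module k N] [Module B N]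
    [IsScalarTower k B N] {W : ModuleCat.{u} B} (e : N ≃ₗ[B] W) :
    ModuleCat.of (A ⊗[k] B) (OuterTensor k T N) ≅ (outerFunctor k A B T).obj W :=
  (OuterTensor.congr (LinearEquiv.refl A T) e).toModuleIso

open scoped ModuleCat in
lemma shortExact_outerFunctor {S : ShortComplex (ModuleCat.{u} B)} (hS : S.ShortExact) :
    (S.map (outerFunctor k A B T)).ShortExact where
  exact := (ShortComplex.ShortExact.moduleCat_exact_iff_function_exact _).2 <|
    lTensor_exact (R := k) T (f := S.f.hom.restrictScalars k) (g := S.g.hom.restrictScalars k)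
      ((ShortComplex.ShortExact.moduleCat_exact_iff_function_exact _).1 hS.exact)
      hS.moduleCat_surjective_g
  mono_f := (ModuleCat.mono_iff_injective _).2 <|
    Module.Flat.lTensor_preserves_injective_linearMap (S.f.hom.restrictScalars k)
      hS.moduleCat_injective_f
  epi_g := (ModuleCat.epi_iff_surjective _).2 <|
    LinearMap.lTensor_surjective T (g := S.g.hom.restrictScalars k) hS.moduleCat_surjective_g

end

section

variable (A) (T V : Type u) [AddCommGroup T] [Module k T] [Module A T] [IsScalarTower k A T]
  [AddCommGroup V] [Module k V]

/-- The map `T ⊗ D(V) → Hom_A(A ⊗ V, T)`, `t ⊗ φ ↦ (a ⊗ v ↦ φ(v) a t)`. -/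
def outerDualHom : T ⊗[k] Module.Dual k V →ₗ[k] (A ⊗[k] V →ₗ[A] T) :=
  TensorProduct.lift <| LinearMap.mk₂ k
    (fun t φ => TensorProduct.AlgebraTensorModule.lift
      (LinearMap.toSpanSingleton A (V →ₗ[k] T) (φ.smulRight t)))
    (fun t t' φ => by ext; simp) (fun c t φ => by ext; simp [smul_comm c])
    (fun t φ φ' => by ext; simp [add_smul]) (fun c t φ => by ext; simp [mul_smul])

variable {A T V} in
lemma outerDualHom_tmul (t : T) (φ : Module.Dual k V) (a : A) (v : V) :
    outerDualHom A T V (t ⊗ₜ[k] φ) (a ⊗ₜ[k] v) = a • φ v • t := by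
  simp [outerDualHom]

lemma outerDualHom_bijective [Module.Finite k V] :
    Function.Bijective (outerDualHom (k := k) A T V) := by
  -- A map on `A ⊗ V` is determined by its restriction to `1 ⊗ V`.
  have h : ∀ z v, outerDualHom (k := k) A T V z (1 ⊗ₜ[k] v) =
      dualTensorHom k V T (TensorProduct.comm k _ _ z) v := by
    intro z v
    induction z using TensorProduct.induction_on with
    | zero => simp
    | tmul t φ => simp [outerDualHom_tmul]
    | add x y hx hy => simp [hx, hy]
  have hb : Function.Bijective fun z : T ⊗[k] Module.Dual k V =>
      dualTensorHom k V T (TensorProduct.comm k _ _ z) :=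
    ((TensorProduct.comm k _ _).trans (dualTensorHomEquiv k V T)).bijective
  constructor
  · intro x y hxy
    exact hb.1 (LinearMap.ext fun v => by rw [← h, ← h, hxy])
  · intro f
    obtain ⟨z, hz⟩ := hb.2 (f.restrictScalars k ∘ₗ TensorProduct.mk k A V 1)
    refine ⟨z, ?_⟩
    ext v
    exact (h z v).trans (LinearMap.congr_fun hz v)

variable (B) in
/-- The isomorphism `T ⊗ D(V) ≅ Hom_A(A ⊗ V, T)` for a finite-dimensional right `B`-module `V`. -/
def outerDualEquiv [Module Bᵐᵒᵖ V] [IsScalarTower k Bᵐᵒᵖ V] [Module.Finite k V] :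
    OuterTensor k T (DualModule k V) ≃ₗ[A ⊗[k] B] HomModule A (InducedBimodule k A V) T :=
  let f : OuterTensor k T (DualModule k V) →ₗ[A ⊗[k] B] HomModule A (InducedBimodule k A V) T :=
    OuterTensor.linearMap (N := DualModule k V) (outerDualHom A T V).toAddMonoidHom
      fun a b t φ => TensorProduct.AlgebraTensorModule.curry_injective <| LinearMap.ext fun a' =>
        LinearMap.ext fun v => by
          change outerDualHom A T V ((a • t) ⊗ₜ[k] (show Module.Dual k V from b • φ))
              (a' ⊗ₜ[k] v) =
            outerDualHom A T V (t ⊗ₜ[k] (show Module.Dual k V from φ))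
              ((a' * a) ⊗ₜ[k] (op b • v))
          rw [outerDualHom_tmul, outerDualHom_tmul, mul_smul, smul_comm a]
          rfl
  have hf : Function.Bijective f := outerDualHom_bijective A T V
  LinearEquiv.ofBijective f hf

instance [Module.Finite k A] [Module.Finite k V] : Module.Finite A (InducedBimodule k A V) :=
  have : Module.Finite k (A ⊗[k] V) := inferInstance
  have : Module.Finite A (A ⊗[k] V) := Module.Finite.of_restrictScalars_finite k A _
  this

instance : Module.Projective A (InducedBimodule k A V) :=
  inferInstanceAs (Module.Projective A (A ⊗[k] V))

end

end Outer

/-! ### The monomorphism category and vanishing of `Ext` -/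

section Monic

variable {k A B : Type u} [Field k] [Ring A] [Algebra k A] [Ring B] [Algebra k B]

lemma exists_hasProjectiveDimensionLT (hB : globalDimension B < ⊤) (M : ModuleCat.{u} B)
    [Module.Finite B M] : ∃ n, HasProjectiveDimensionLT M n := by
  have h : projectiveDimension M ≤ globalDimension B :=
    le_iSup₂ (f := fun (M : ModuleCat.{u} B) (_ : Module.Finite B M) => projectiveDimension M) M ‹_›
  obtain ⟨n, hn⟩ := (projectiveDimension_ne_top_iff M).1 (h.trans_lt hB).ne
  exact ⟨n + 1, hn⟩

lemma isNoetherianRing_of_finite (k B : Type u) [Field k] [Ring B] [Algebra k B]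
    [Module.Finite k B] : IsNoetherianRing B :=
  isNoetherian_of_tower k inferInstance

lemma finite_of_finite_op [Module.Finite k B] (V : Type u) [AddCommGroup V] [Module k V]
    [Module Bᵐᵒᵖ V] [IsScalarTower k Bᵐᵒᵖ V] [Module.Finite Bᵐᵒᵖ V] : Module.Finite k V :=
  Module.Finite.trans Bᵐᵒᵖ V

/-- The functor `T ↦ Hom_A(A ⊗ V, T) ≅ Hom_k(V, T)`, right adjoint to `X ↦ (A ⊗ V) ⊗_{A ⊗ B} X`. -/
abbrev coinducedFunctor (k A B V : Type u) [Field k] [Ring A] [Algebra k A] [Ring B] [Algebra k B]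
    [AddCommGroup V] [Module k V] [Module Bᵐᵒᵖ V] [IsScalarTower k Bᵐᵒᵖ V] :
    ModuleCat.{u} A ⥤ ModuleCat.{u} (A ⊗[k] B) :=
  homFunctor A (A ⊗[k] B) (InducedBimodule k A V)

variable (B) in
/-- The vanishing of `Tor_i(A ⊗ V, X)` is the vanishing of `Ext^i(X, Hom_k(V, D(A)))`. -/
lemma forall_isZero_torModule_iff (V : Type u) [AddCommGroup V] [Module k V]
    [Module Bᵐᵒᵖ V] [IsScalarTower k Bᵐᵒᵖ V] (X : ModuleCat.{u} (A ⊗[k] B)) :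
    (∀ i : ℕ, 1 ≤ i →
        Limits.IsZero (torModule A (A ⊗[k] B) (InducedBimodule k A V) i X)) ↔
      rightPerp X ((coinducedFunctor k A B V).obj (ModuleCat.of A (DualModule k A))) :=
  forall_isZero_leftDerived_iff (tensorHomAdjunction A (A ⊗[k] B) (InducedBimodule k A V))
    (isCoseparator_dualModule k A) X

section

variable [Module.Finite k B] (X : ModuleCat.{u} (A ⊗[k] B))
  (T : Type u) [AddCommGroup T] [Module k T] [Module A T] [IsScalarTower k A T]

/-- The module `T ⊗ B` is coinduced from `T`, along the right `B`-module `V = D(B)`. -/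
lemma rightPerp_coinduced_rightDual_iff :
    rightPerp X ((coinducedFunctor k A B (RightDual k B)).obj (ModuleCat.of A T)) ↔
      rightPerp X (ModuleCat.of (A ⊗[k] B) (OuterTensor k T B)) := by
  let e : ModuleCat.of (A ⊗[k] B) (OuterTensor k T B) ≅
      (coinducedFunctor k A B (RightDual k B)).obj (ModuleCat.of A T) :=
    ((OuterTensor.congr (LinearEquiv.refl A T) (evalRightDual k B B)).trans
      (outerDualEquiv A B T (RightDual k B))).toModuleIso
  exact ⟨(rightPerp_cokernelClosed X).iso e.symm, (rightPerp_cokernelClosed X).iso e⟩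

variable {X T} in
/-- As `B` has finite global dimension, `Ext(X, T ⊗ W)` vanishes for all finitely generated `W` as
soon as it vanishes for `W = B`; here `W = D(V)`. -/
lemma rightPerp_coinduced (hB : globalDimension B < ⊤)
    (h : rightPerp X (ModuleCat.of (A ⊗[k] B) (OuterTensor k T B)))
    (V : Type u) [AddCommGroup V] [Module k V] [Module Bᵐᵒᵖ V] [IsScalarTower k Bᵐᵒᵖ V]
    [Module.Finite Bᵐᵒᵖ V] :
    rightPerp X ((coinducedFunctor k A B V).obj (ModuleCat.of A T)) := by
  have : Module.Finite k V := finite_of_finite_op (B := B) V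
  have : Module.Finite B (DualModule k V) := Module.Finite.of_restrictScalars_finite k B _
  have := isNoetherianRing_of_finite k B
  have hQ := (rightPerp_cokernelClosed X).inverseImage (outerFunctor k A B T)
    (shortExact_outerFunctor T)
  obtain ⟨n, hn⟩ := exists_hasProjectiveDimensionLT hB (ModuleCat.of B (DualModule k V))
  have hW := hQ.of_hasProjectiveDimensionLT
    ((rightPerp_cokernelClosed X).iso (outerFunctorObjIso (LinearEquiv.refl B B)) h) n
    (DualModule k V)
  exact (rightPerp_cokernelClosed X).iso
    ((outerFunctorObjIso (LinearEquiv.refl B (DualModule k V))).symm ≪≫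
      (outerDualEquiv A B T V).toModuleIso) hW

end

lemma leftPerp_outerTensor_regular :
    leftPerp (ModuleCat.of (A ⊗[k] B) (OuterTensor k A B)) =
      leftPerp (ModuleCat.of (A ⊗[k] B) (A ⊗[k] B)) := by
  have e := (outerRegular k A B).toModuleIso
  ext X
  exact and_congr_right fun _ => ⟨(rightPerp_cokernelClosed X).iso e,
    (rightPerp_cokernelClosed X).iso e.symm⟩

variable [Module.Finite k B]

lemma finite_tensorFunctor_inducedBimodule [Module.Finite k A] (V : Type u) [AddCommGroup V]
    [Module k V] [Module Bᵐᵒᵖ V] [IsScalarTower k Bᵐᵒᵖ V] [Module.Finite Bᵐᵒᵖ V]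
    (X : ModuleCat.{u} (A ⊗[k] B)) [Module.Finite (A ⊗[k] B) X] :
    Module.Finite A ((tensorFunctor A (A ⊗[k] B) (InducedBimodule k A V)).obj X) :=
  have : Module.Finite k V := finite_of_finite_op (B := B) V
  finite_tensorFunctor A (A ⊗[k] B) (InducedBimodule k A V) X

/-- `mon(B, ⊥T) = mon(B, A) ∩ ⊥(T ⊗ B)`. -/
lemma monOver_leftPerp [Module.Finite k A] (hB : globalDimension B < ⊤) (T : Type u)
    [AddCommGroup T] [Module k T] [Module A T] [IsScalarTower k A T] :
    monOver k B (leftPerp (ModuleCat.of A T)) =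
      mon k A B ⊓ leftPerp (ModuleCat.of (A ⊗[k] B) (OuterTensor k T B)) := by
  have key : ∀ X, mon k A B X → ∀ (V : Type u) [AddCommGroup V] [Module k V]
      [Module Bᵐᵒᵖ V] [IsScalarTower k Bᵐᵒᵖ V] [Module.Finite Bᵐᵒᵖ V],
      rightPerp X ((coinducedFunctor k A B V).obj (ModuleCat.of A T)) ↔
        rightPerp ((tensorFunctor A (A ⊗[k] B) (InducedBimodule k A V)).obj X)
          (ModuleCat.of A T) := fun X hX V _ _ _ _ _ =>
    rightPerp_map_iff (tensorHomAdjunction A (A ⊗[k] B) (InducedBimodule k A V))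
      (projective_tensorFunctor A (A ⊗[k] B) (InducedBimodule k A V)) (hX.2 V) (ModuleCat.of A T)
  have : Module.Finite Bᵐᵒᵖ (RightDual k B) := Module.Finite.of_restrictScalars_finite k Bᵐᵒᵖ _
  ext X
  constructor
  · rintro ⟨hX, hV⟩
    exact ⟨hX, hX.1, (rightPerp_coinduced_rightDual_iff X T).1
      ((key X hX (RightDual k B)).2 (hV (RightDual k B)).2)⟩
  · rintro ⟨hX, -, hT⟩
    have := hX.1
    refine ⟨hX, fun V _ _ _ _ _ => ⟨finite_tensorFunctor_inducedBimodule V X,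
      (key X hX V).1 (rightPerp_coinduced hB hT V)⟩⟩

/-- If every class as in `CokernelClosed` that contains `T` also contains `D(A)`, then `⊥(T ⊗ B)` is
contained in `mon(B, A)`. -/
lemma leftPerp_le_mon (hB : globalDimension B < ⊤) (T : Type u) [AddCommGroup T] [Module k T]
    [Module A T] [IsScalarTower k A T]
    (hT : ∀ Q : ObjectProperty (ModuleCat.{u} A), CokernelClosed Q → Q (ModuleCat.of A T) →
      Q (ModuleCat.of A (DualModule k A))) :
    leftPerp (ModuleCat.of (A ⊗[k] B) (OuterTensor k T B)) ≤ mon k A B := by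
  rintro X ⟨hX, h⟩
  refine ⟨hX, fun V _ _ _ _ _ => (forall_isZero_torModule_iff B V X).2 ?_⟩
  refine rightPerp_coinduced hB ((rightPerp_coinduced_rightDual_iff X (DualModule k A)).1 ?_) V
  exact hT _ ((rightPerp_cokernelClosed X).inverseImage (coinducedFunctor k A B (RightDual k B))
    (shortExact_homFunctor _ _ _)) ((rightPerp_coinduced_rightDual_iff X T).2 h)

end Monic

end

end MonicModules

theorem theorem3p1 {k A B T : Type u} [Field k]
    [Ring A] [Algebra k A] [Module.Finite k A] [Ring B] [Algebra k B] [Module.Finite k B]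
    [AddCommGroup T] [Module k T] [Module A T] [IsScalarTower k A T] [Module.Finite A T]
    (hB : MonicModules.globalDimension B < ⊤) :
    (MonicModules.monOver k B (MonicModules.leftPerp (ModuleCat.of A T)) =
      MonicModules.mon k A B ⊓ MonicModules.leftPerp (ModuleCat.of (A ⊗[k] B) (MonicModules.OuterTensor k T B))) ∧
    (MonicModules.HasFiniteAddResolution (ModuleCat.of A T) (ModuleCat.of A (MonicModules.DualModule k A)) →
      MonicModules.monOver k B (MonicModules.leftPerp (ModuleCat.of A T)) =
        MonicModules.leftPerp (ModuleCat.of (A ⊗[k] B) (MonicModules.OuterTensor k T B))) ∧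
    (MonicModules.monOver k B (MonicModules.leftPerp (ModuleCat.of A A)) =
      MonicModules.mon k A B ⊓ MonicModules.leftPerp (ModuleCat.of (A ⊗[k] B) (A ⊗[k] B))) ∧
    (injectiveDimension (ModuleCat.of Aᵐᵒᵖ A) < ⊤ →
      MonicModules.leftPerp (ModuleCat.of (A ⊗[k] B) (A ⊗[k] B)) =
        MonicModules.monOver k B (MonicModules.leftPerp (ModuleCat.of A A))) := by
  open MonicModules in
  refine ⟨monOver_leftPerp hB T, fun h => ?_, ?_, fun h => ?_⟩
  · rw [monOver_leftPerp hB T]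
    exact inf_eq_right.2 (leftPerp_le_mon hB T fun Q hQ hT => hQ.of_hasFiniteAddResolution hT h)
  · rw [monOver_leftPerp hB A, leftPerp_outerTensor_regular]
  · rw [monOver_leftPerp hB A, ← leftPerp_outerTensor_regular]
    refine (inf_eq_right.2 (leftPerp_le_mon hB A fun Q hQ hA => ?_)).symm
    obtain ⟨n, hn⟩ := (injectiveDimension_ne_top_iff _).1 h.ne
    have : HasInjectiveDimensionLT (ModuleCat.of Aᵐᵒᵖ (RightDual k (DualModule k A))) (n + 1) :=
      hasInjectiveDimensionLT_of_iso (evalDualModule k A).toModuleIso (n + 1)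
    exact hQ.of_hasInjectiveDimensionLT_rightDual (k := k) hA (n + 1) (DualModule k A)
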